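/- Let $M$ be a smooth $n$-dimensional manifold and let $K$ be a smooth $(1,1)$-tensor field on $M$, viewed as a field of endomorphisms $K_x:T_xM\to T_xM$. Eigenvalues may be complex; eigenvalues, eigenvectors and Jordan blocks of $K_x$ are those of its complexification on $T_xM\otimes\mathbb C$. Assume that $K$ is gl-regular, that is, at every point each eigenvalue has a one-dimensional eigenspace, and define the functions $\sigma_1,\dots,\sigma_n$ by $$\det(t\,\mathrm{Id}-K)=t^n-\sigma_1t^{n-1}-\sigma_2t^{n-2}-\dots-\sigma_n .$$ Call a point algebraically generic if the Segre characteristic of $K$ (the number of distinct eigenvalues together with the sizes of the Jordan blocks belonging to each of them) is constant in a neighbourhood of the point. Call $K$ weakly nonlinear at a point $p$ if every eigenvalue of $K_p$ extends to a smooth eigenvalue function of $K$ near $p$, and for every eigenvalue $\mu$ of $K_p$ and every smooth eigenvalue function $\lambda$ of $K$ near $p$ with $\lambda(p)=\mu$, the complex-linear extension of $d\lambda_p$ vanishes on the eigenvectors of $K_p$ with eigenvalue $\mu$. Let $K^*$ be the dual operator on covectors, $(K^*\alpha)(\xi)=\alpha(K\xi)$, and consider the equation $$(K^*)^{n-1}d\sigma_1+(K^*)^{n-2}d\sigma_2+\dots+(K^*)^0d\sigma_n=0.\qquad(*)$$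 Then: 1. at each algebraically generic point $p$, $K$ is weakly nonlinear at $p$ if and only if $(*)$ holds at $p$; 2. $K$ is weakly nonlinear at all algebraically generic points if and only if $(*)$ holds at every point of $M$. -/

import Mathlib

open scoped Manifold ContDiff TensorProduct Topology

noncomputable section

namespace HydroTensor

/-! ### Linear algebra: Jordan structure of a complex operator -/

section LinearAlgebra

variable {W : Type*} [AddCommGroup W] [Module ℂ W] [FiniteDimensional ℂ W]

/-- The dimension of the kernel of `(A - μ)^k`. -/
def kerDim (A : Module.End ℂ W) (μ : ℂ) (k : ℕ) : ℕ :=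
  Module.finrank ℂ (LinearMap.ker ((A - algebraMap ℂ (Module.End ℂ W) μ) ^ k))

/-- The number of Jordan blocks of size `k ≥ 1` with eigenvalue `μ` in the Jordan normal form
of `A`. The blocks of size at least `k` number `kerDim A μ k - kerDim A μ (k - 1)`, and those of
size at least `k + 1` number `kerDim A μ (k + 1) - kerDim A μ k`. -/
def jordanBlockCount (A : Module.End ℂ W) (μ : ℂ) (k : ℕ) : ℕ :=
  (kerDim A μ k - kerDim A μ (k - 1)) - (kerDim A μ (k + 1) - kerDim A μ k)

/-- The multiset of the sizes of the Jordan blocks of `A` with eigenvalue `μ`. -/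
def jordanBlockSizes (A : Module.End ℂ W) (μ : ℂ) : Multiset ℕ :=
  ∑ k ∈ Finset.Icc 1 (Module.finrank ℂ W), Multiset.replicate (jordanBlockCount A μ k) k

open Classical in
/-- The Segre characteristic of `A`: for every distinct eigenvalue, the multiset of the sizes of
its Jordan blocks; the values of the eigenvalues are forgotten. -/
def segreCharacteristic (A : Module.End ℂ W) : Multiset (Multiset ℕ) :=
  A.charpoly.roots.dedup.map (jordanBlockSizes A)

end LinearAlgebra

/-! ### (1,1)-tensor fields on a manifold -/

section Tensor

variable {n : ℕ} {M : Type*} [TopologicalSpace M] [ChartedSpace (EuclideanSpace ℝ (Fin n)) M]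

instance tangentSpace_finite (x : M) : Module.Finite ℝ (TangentSpace (𝓡 n) x) :=
  inferInstanceAs (Module.Finite ℝ (EuclideanSpace ℝ (Fin n)))

variable (n M) in
/-- A field (with no regularity assumed) of endomorphisms of the tangent spaces of `M`. -/
abbrev EndField : Type _ :=
  ∀ x : M, TangentSpace (𝓡 n) x →L[ℝ] TangentSpace (𝓡 n) x

/-- Smoothness of an endomorphism field, as a section of the bundle `Hom(TM, TM)`. -/
def IsSmooth [IsManifold (𝓡 n) ∞ M] (K : EndField n M) : Prop :=
  ContMDiff (𝓡 n)
    ((𝓡 n).prod 𝓘(ℝ, EuclideanSpace ℝ (Fin n) →L[ℝ] EuclideanSpace ℝ (Fin n))) ∞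
    (fun x : M ↦ Bundle.TotalSpace.mk'
      (E := fun x : M ↦ TangentSpace (𝓡 n) x →L[ℝ] TangentSpace (𝓡 n) x)
      (EuclideanSpace ℝ (Fin n) →L[ℝ] EuclideanSpace ℝ (Fin n)) x (K x))

/-- The complexification of `K` at `x`, acting on the complexified tangent space. -/
def complexify (K : EndField n M) (x : M) : Module.End ℂ (ℂ ⊗[ℝ] TangentSpace (𝓡 n) x) :=
  (K x).toLinearMap.baseChange ℂ

/-- `K` is gl-regular: at every point, every (real or complex) eigenvalue has geometric
multiplicity one. -/
def IsGLRegular (K : EndField n M) : Prop :=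
  ∀ (x : M) (μ : ℂ), (complexify K x).HasEigenvalue μ →
    Module.finrank ℂ ((complexify K x).eigenspace μ) = 1

/-- `p` is algebraically generic for `K`: the Segre characteristic is constant near `p`. -/
def IsAlgebraicallyGeneric (K : EndField n M) (p : M) : Prop :=
  ∀ᶠ x in 𝓝 p, segreCharacteristic (complexify K x) = segreCharacteristic (complexify K p)

/-- `lam` is, near `p`, a smooth (possibly complex-valued) eigenvalue function of `K`. -/
def IsEigenvalueFunctionNear (K : EndField n M) (p : M) (lam : M → ℂ) : Prop :=
  ∃ U : Set M, IsOpen U ∧ p ∈ U ∧ ContMDiffOn (𝓡 n) 𝓘(ℝ, ℂ) ∞ lam U ∧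
    ∀ x ∈ U, (complexify K x).HasEigenvalue (lam x)

/-- The differential at `p` of a complex-valued function, extended complex-linearly to the
complexified tangent space. -/
def complexDifferential (lam : M → ℂ) (p : M) : ℂ ⊗[ℝ] TangentSpace (𝓡 n) p →ₗ[ℂ] ℂ :=
  LinearMap.liftBaseChange ℂ
    (show TangentSpace (𝓡 n) p →ₗ[ℝ] ℂ from (mfderiv (𝓡 n) 𝓘(ℝ, ℂ) lam p).toLinearMap)

/-- `K` is weakly nonlinear at `p`: every eigenvalue of `K` at `p` extends to a smooth eigenvalue
function near `p`, and the derivative of any such function at `p` along any eigenvector with that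
eigenvalue is zero. -/
def IsWeaklyNonlinearAt (K : EndField n M) (p : M) : Prop :=
  ∀ μ : ℂ, (complexify K p).HasEigenvalue μ →
    (∃ lam : M → ℂ, IsEigenvalueFunctionNear K p lam ∧ lam p = μ) ∧
    ∀ lam : M → ℂ, IsEigenvalueFunctionNear K p lam → lam p = μ →
      ∀ v : ℂ ⊗[ℝ] TangentSpace (𝓡 n) p, (complexify K p).HasEigenvector μ v →
        complexDifferential lam p v = 0

/-- The functions `σ_j`, `1 ≤ j ≤ n`, with
`det (t Id - K) = t^n - σ_1 t^(n-1) - … - σ_n`. -/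
def sigma (K : EndField n M) (j : ℕ) (x : M) : ℝ :=
  -((K x).toLinearMap.charpoly.coeff (n - j))

/-- The differential of a real-valued function at `p`, as a covector. -/
def differential (f : M → ℝ) (p : M) : Module.Dual ℝ (TangentSpace (𝓡 n) p) :=
  (mfderiv (𝓡 n) 𝓘(ℝ, ℝ) f p).toLinearMap

/-- The dual operator `K*` on covectors at `x`, `(K* α)(ξ) = α (K ξ)`. -/
def dualOperator (K : EndField n M) (x : M) :
    Module.End ℝ (Module.Dual ℝ (TangentSpace (𝓡 n) x)) :=
  (K x).toLinearMap.dualMap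

/-- The covector `(K*)^(n-1) dσ_1 + (K*)^(n-2) dσ_2 + … + (K*)^0 dσ_n` at `x`. -/
def sigmaForm (K : EndField n M) (x : M) : Module.Dual ℝ (TangentSpace (𝓡 n) x) :=
  ∑ j ∈ Finset.Icc 1 n, (dualOperator K x ^ (n - j)) (differential (sigma K j) x)

end Tensor

end HydroTensor

end

noncomputable section

namespace HydroTensor

/-! ### Roots of monic polynomials depending on a parameter -/

section RootContinuity

open Polynomial Filter

variable {Y : Type*} [TopologicalSpace Y] {P : Y → ℂ[X]} {p : Y} {n : ℕ}

/-! Near an algebraically generic point `p` the characteristic polynomial `χ` factors as a product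
of `(t - ψ_μ)^{m_μ}` with smooth `ψ_μ` extending the eigenvalues `μ` at `p`
(`exists_smooth_factorization`). Differentiating at `p` and comparing coefficients gives `dσ_j = ∑
m_μ (q_μ)_{n-j} dψ_μ`, where `q_μ = χ/(t - μ)` and the index denotes a coefficient. Substituting `K`
for `t`, the complexified left side of `(*)` is `∑ m_μ dψ_μ ∘ q_μ(K)` (`liftBaseChange_sigmaForm`).

By Cayley–Hamilton, `q_μ(K)` takes values in the `μ`-eigenspace, so weak nonlinearity makes every
term vanish. Conversely, gl-regularity leaves one Jordan block per eigenvalue, so `q_μ(K)` maps the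
generalized `μ`-eigenspace onto the eigenline (`exists_aeval_divByMonic_eq`), while `q_ν(K)` kills
that space for `ν ≠ μ`. Evaluating `(*)` there isolates `dψ_μ` on the eigenvectors.

For the global statement, `(*)` is a closed condition and generic points are dense: the number of
distinct eigenvalues is bounded and lower semicontinuous, and where it is locally constant so are
the multiplicities, which for gl-regular `K` determine the Segre characteristic. -/

theorem eval_iterate_derivative_eq_sum {n : ℕ} (m : ℕ) {Q : ℂ[X]} (hQ : Q.natDegree ≤ n) (t : ℂ) :
    (derivative^[m] Q).eval t =
      ∑ k ∈ Finset.range (n + 1), ((k + m).descFactorial m : ℂ) * Q.coeff (k + m) * t ^ k := by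
  rw [eval_eq_sum_range' (n := n + 1)]
  · simp [coeff_iterate_derivative]
  · exact Nat.lt_succ_of_le ((natDegree_iterate_derivative Q m).trans (by omega))

/-- The uniform degree bound turns evaluation into a sum of fixed length, continuous jointly in the
parameter and the point. -/
theorem continuousAt_eval_iterate_derivative (hdeg : ∀ x, (P x).natDegree ≤ n)
    (hc : ∀ k, ContinuousAt (fun x ↦ (P x).coeff k) p) (m : ℕ) (μ : ℂ) :
    ContinuousAt (fun q : Y × ℂ ↦ (derivative^[m] (P q.1)).eval q.2) (p, μ) := by
  simp_rw [fun q : Y × ℂ ↦ eval_iterate_derivative_eq_sum m (hdeg q.1) q.2]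
  refine tendsto_finsetSum _ fun k _ ↦ ?_
  have h : ContinuousAt (fun q : Y × ℂ ↦ (P q.1).coeff (k + m)) (p, μ) :=
    ContinuousAt.comp (f := Prod.fst) (g := fun x ↦ (P x).coeff (k + m)) (hc _) continuousAt_fst
  exact (continuousAt_const.mul h).mul (continuousAt_snd.pow k)

/-- Near a root of `P p`, every nearby polynomial has a root. -/
theorem eventually_exists_root_near (hmon : ∀ x, (P x).Monic) (hdeg : ∀ x, (P x).natDegree = n)
    (hc : ∀ k, ContinuousAt (fun x ↦ (P x).coeff k) p) {μ : ℂ} (hμ : (P p).IsRoot μ)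
    {V : Set ℂ} (hV : V ∈ 𝓝 μ) : ∀ᶠ x in 𝓝 p, ∃ t ∈ V, (P x).IsRoot t := by
  obtain ⟨ε, hε, hεV⟩ := Metric.mem_nhds_iff.1 hV
  have hcont : ContinuousAt (fun x ↦ (P x).eval μ) p :=
    ContinuousAt.comp (f := fun x ↦ (x, μ)) (g := fun q : Y × ℂ ↦ (P q.1).eval q.2)
      (continuousAt_eval_iterate_derivative (fun x ↦ (hdeg x).le) hc 0 μ)
      (continuousAt_id.prodMk continuousAt_const)
  have h0 : Tendsto (fun x ↦ ‖(P x).eval μ‖) (𝓝 p) (𝓝 0) := by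
    have := hcont.norm.tendsto
    rwa [hμ.eq_zero, norm_zero] at this
  -- If all `n` roots stayed at distance at least `ε` from `μ`, the product formula would give a
  -- value of norm at least `ε ^ n` at `μ`.
  filter_upwards [h0.eventually (gt_mem_nhds (pow_pos hε n))] with x hx
  by_contra! hno
  have hsplit := IsAlgClosed.splits (P x)
  have hcard : (P x).roots.card = n := by rw [← hsplit.natDegree_eq_card_roots, hdeg]
  have hev : (P x).eval μ = ((P x).roots.map fun r ↦ μ - r).prod := by
    conv_lhs => rw [hsplit.eq_prod_roots_of_monic (hmon x)]
    rw [eval_multiset_prod, Multiset.map_map]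
    simp
  refine hx.not_ge ?_
  rw [hev, ← hcard]
  have hle : ∀ s : Multiset ℂ, (∀ r ∈ s, ε ≤ ‖μ - r‖) →
      ε ^ s.card ≤ ‖(s.map fun r ↦ μ - r).prod‖ := by
    intro s
    induction s using Multiset.induction_on with
    | empty => simp
    | cons a s ih =>
      intro hs
      simp only [Multiset.card_cons, Multiset.map_cons, Multiset.prod_cons, norm_mul, pow_succ']
      exact mul_le_mul (hs a (by simp)) (ih fun r hr ↦ hs r (by simp [hr])) (by positivity)
        (norm_nonneg _)
  refine hle _ fun r hr ↦ ?_
  by_contra! hlt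
  refine hno r (hεV ?_) (isRoot_of_mem_roots hr)
  rwa [Metric.mem_ball, dist_comm, dist_eq_norm]

/-- Root multiplicities are upper semicontinuous. -/
theorem eventually_rootMultiplicity_le (hmon : ∀ x, (P x).Monic)
    (hdeg : ∀ x, (P x).natDegree = n)
    (hc : ∀ k, ContinuousAt (fun x ↦ (P x).coeff k) p) (μ : ℂ) :
    ∀ᶠ q : Y × ℂ in 𝓝 (p, μ),
      (P q.1).rootMultiplicity q.2 ≤ (P p).rootMultiplicity μ := by
  have hne : ∃ m ≤ (P p).rootMultiplicity μ, (derivative^[m] (P p)).eval μ ≠ 0 := by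
    by_contra! h
    exact lt_irrefl _ ((lt_rootMultiplicity_iff_isRoot_iterate_derivative (hmon p).ne_zero).2 h)
  obtain ⟨m, hm, hne⟩ := hne
  have hcont := continuousAt_eval_iterate_derivative (fun x ↦ (hdeg x).le) hc m μ
  filter_upwards [hcont.eventually_ne hne] with q hq
  by_contra! hlt
  exact hq (isRoot_iterate_derivative_of_lt_rootMultiplicity (hm.trans_lt hlt))

theorem sum_rootMultiplicity_eq {Q : ℂ[X]} :
    ∑ μ ∈ Q.roots.toFinset, Q.rootMultiplicity μ = Q.natDegree := by
  rw [(IsAlgClosed.splits Q).natDegree_eq_card_roots, ← Multiset.toFinset_sum_count_eq]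
  simp

/-- Nearby polynomials have distinct roots close to the distinct roots of `P p`. -/
theorem eventually_exists_root_map (hmon : ∀ x, (P x).Monic) (hdeg : ∀ x, (P x).natDegree = n)
    (hc : ∀ k, ContinuousAt (fun x ↦ (P x).coeff k) p) {S : ℂ → Y → ℂ → Prop}
    (hS : ∀ μ, (P p).IsRoot μ → ∀ᶠ q : Y × ℂ in 𝓝 (p, μ), S μ q.1 q.2) :
    ∀ᶠ x in 𝓝 p, ∃ r : ℂ → ℂ, Set.InjOn r (P p).roots.toFinset ∧
      ∀ μ ∈ (P p).roots.toFinset, r μ ∈ (P x).roots.toFinset ∧ S μ x (r μ) := by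
  -- Choosing the nearby roots in pairwise disjoint neighbourhoods makes the choice injective.
  obtain ⟨U, hU, hdisj⟩ := (P p).roots.toFinset.finite_toSet.t2_separation
  have hμ : ∀ μ ∈ (P p).roots.toFinset,
      ∀ᶠ x in 𝓝 p, ∃ t ∈ U μ, (P x).IsRoot t ∧ S μ x t := by
    intro μ hμ
    have hroot : (P p).IsRoot μ := isRoot_of_mem_roots (Multiset.mem_toFinset.1 hμ)
    have h := hS μ hroot
    rw [nhds_prod_eq, eventually_prod_iff] at h
    obtain ⟨pa, ha, pb, hb, hab⟩ := h
    filter_upwards [ha, eventually_exists_root_near hmon hdeg hc hroot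
      (inter_mem ((hU μ).2.mem_nhds (hU μ).1) hb)] with x hx ⟨t, ht, htr⟩
    exact ⟨t, ht.1, htr, hab hx ht.2⟩
  filter_upwards [(Filter.eventually_all_finset _).2 hμ] with x hx
  choose! r hrU hrr hrS using hx
  refine ⟨r, fun μ hμ ν hν h ↦ ?_, fun μ hμ ↦ ⟨?_, hrS μ hμ⟩⟩
  · by_contra hne
    exact Set.disjoint_left.1 (hdisj hμ hν hne) (hrU μ hμ) (h ▸ hrU ν hν)
  · rw [Multiset.mem_toFinset, mem_roots (hmon x).ne_zero]
    exact hrr μ hμ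

/-- The number of distinct roots is lower semicontinuous. -/
theorem eventually_card_roots_le (hmon : ∀ x, (P x).Monic) (hdeg : ∀ x, (P x).natDegree = n)
    (hc : ∀ k, ContinuousAt (fun x ↦ (P x).coeff k) p) :
    ∀ᶠ x in 𝓝 p, (P p).roots.toFinset.card ≤ (P x).roots.toFinset.card := by
  filter_upwards [eventually_exists_root_map hmon hdeg hc (S := fun _ _ _ ↦ True)
    fun μ _ ↦ Eventually.of_forall fun _ ↦ trivial] with x ⟨r, hinj, hr⟩
  exact Finset.card_le_card_of_injOn r (fun μ hμ ↦ (hr μ hμ).1) hinj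

/-- If the number of distinct roots is locally constant, then the roots can be followed with
constant multiplicities. -/
theorem eventually_exists_root_bijOn (hmon : ∀ x, (P x).Monic) (hdeg : ∀ x, (P x).natDegree = n)
    (hc : ∀ k, ContinuousAt (fun x ↦ (P x).coeff k) p)
    (hcard : ∀ᶠ x in 𝓝 p, (P x).roots.toFinset.card = (P p).roots.toFinset.card)
    {S : ℂ → Y → ℂ → Prop}
    (hS : ∀ μ, (P p).IsRoot μ → ∀ᶠ q : Y × ℂ in 𝓝 (p, μ), S μ q.1 q.2) :
    ∀ᶠ x in 𝓝 p, ∃ r : ℂ → ℂ, Set.BijOn r (P p).roots.toFinset (P x).roots.toFinset ∧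
      ∀ μ ∈ (P p).roots.toFinset,
        (P x).rootMultiplicity (r μ) = (P p).rootMultiplicity μ ∧ S μ x (r μ) := by
  filter_upwards [hcard, eventually_exists_root_map hmon hdeg hc
    (S := fun μ x t ↦ (P x).rootMultiplicity t ≤ (P p).rootMultiplicity μ ∧ S μ x t)
    fun μ hμ ↦ (eventually_rootMultiplicity_le hmon hdeg hc μ).and (hS μ hμ)]
    with x hx ⟨r, hinj, hr⟩
  have himage : (P p).roots.toFinset.image r = (P x).roots.toFinset := by
    refine Finset.eq_of_subset_of_card_le ?_ ?_
    · exact Finset.image_subset_iff.2 fun μ hμ ↦ (hr μ hμ).1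
    · rw [Finset.card_image_of_injOn hinj, hx]
  have hbij : Set.BijOn r (P p).roots.toFinset (P x).roots.toFinset := by
    rw [← himage, Finset.coe_image]
    exact hinj.bijOn_image
  refine ⟨r, hbij, fun μ hμ ↦ ⟨?_, (hr μ hμ).2.2⟩⟩
  -- Both sums equal `n`, so the termwise inequality from semicontinuity is an equality.
  have hsum : ∑ μ ∈ (P p).roots.toFinset, (P x).rootMultiplicity (r μ) =
      ∑ μ ∈ (P p).roots.toFinset, (P p).rootMultiplicity μ := by
    rw [sum_rootMultiplicity_eq, hdeg, ← hdeg x, ← sum_rootMultiplicity_eq, ← himage,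
      Finset.sum_image hinj]
  exact (Finset.sum_eq_sum_iff_of_le fun μ hμ ↦ (hr μ hμ).2.1).1 hsum μ hμ

/-- The polynomial with given coefficients. -/
def ofCoeffs {N : ℕ} (a : Fin N → ℂ) : ℂ[X] := ∑ k : Fin N, C (a k) * X ^ (k : ℕ)

theorem ofCoeffs_coeff {N : ℕ} {Q : ℂ[X]} (hQ : Q.natDegree < N) :
    ofCoeffs (fun k : Fin N ↦ Q.coeff k) = Q := by
  rw [ofCoeffs, Fin.sum_univ_eq_sum_range (fun k ↦ C (Q.coeff k) * X ^ k) N]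
  exact (Q.as_sum_range_C_mul_X_pow' hQ).symm

/-- The expression is polynomial in the coefficients and the point together. Regularity `ω` over `ℂ`
is kept because analyticity at one point spreads to a neighbourhood, which the implicit function
needs. -/
theorem contDiff_eval_ofCoeffs {N m : ℕ} :
    ContDiff ℂ ω (fun q : (Fin N → ℂ) × ℂ ↦ (derivative^[m] (ofCoeffs q.1)).eval q.2) := by
  simp only [ofCoeffs, iterate_derivative_sum, iterate_derivative_C_mul,
    iterate_derivative_X_pow_eq_smul, eval_finsetSum, eval_mul, eval_C, eval_smul, eval_pow,
    eval_X]
  fun_prop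

/-- A simple zero of an iterated derivative depends smoothly on the coefficients. -/
theorem exists_contDiffOn_root {N m : ℕ} {a₀ : Fin N → ℂ} {μ : ℂ}
    (h0 : (derivative^[m] (ofCoeffs a₀)).eval μ = 0)
    (h1 : (derivative^[m + 1] (ofCoeffs a₀)).eval μ ≠ 0) :
    ∃ ψ : (Fin N → ℂ) → ℂ, ∃ U : Set (Fin N → ℂ), IsOpen U ∧ a₀ ∈ U ∧ ContDiffOn ℝ ∞ ψ U ∧
      ψ a₀ = μ ∧ ∀ᶠ q : (Fin N → ℂ) × ℂ in 𝓝 (a₀, μ),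
        (derivative^[m] (ofCoeffs q.1)).eval q.2 = 0 → ψ q.1 = q.2 := by
  set f : (Fin N → ℂ) × ℂ → ℂ := fun q ↦ (derivative^[m] (ofCoeffs q.1)).eval q.2 with hf
  have cdf : ContDiffAt ℂ ω f (a₀, μ) := contDiff_eval_ofCoeffs.contDiffAt
  have hd : (fderiv ℂ f (a₀, μ) ∘L .inr ℂ (Fin N → ℂ) ℂ) 1 =
      (derivative^[m + 1] (ofCoeffs a₀)).eval μ := by
    have h2 : HasFDerivAt f (fderiv ℂ f (a₀, μ)) (a₀, μ) :=
      (cdf.differentiableAt (by simp)).hasFDerivAt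
    have h3 : HasFDerivAt (fun t : ℂ ↦ f (a₀, t)) (fderiv ℂ f (a₀, μ) ∘L .inr ℂ (Fin N → ℂ) ℂ) μ :=
      h2.comp μ (hasFDerivAt_prodMk_right a₀ μ)
    have h4 := (derivative^[m] (ofCoeffs a₀)).hasDerivAt μ
    rw [← Function.iterate_succ_apply' derivative] at h4
    exact h3.hasDerivAt.unique h4
  have hinv : (fderiv ℂ f (a₀, μ) ∘L .inr ℂ (Fin N → ℂ) ℂ).IsInvertible := by
    refine ⟨ContinuousLinearEquiv.unitsEquivAut ℂ (Units.mk0 _ h1), ?_⟩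
    ext
    simpa using hd.symm
  refine ⟨cdf.implicitFunction (by simp) hinv, ?_⟩
  have hsm := cdf.contDiffAt_implicitFunction (by simp) hinv
  have han := (hsm.analyticAt).eventually_analyticAt
  obtain ⟨U, hU, hUo, hUa⟩ := eventually_nhds_iff.1 han
  refine ⟨U, hUo, hUa, fun a ha ↦ ?_, cdf.implicitFunction_apply_self _ hinv, ?_⟩
  · exact ((hU a ha).contDiffAt.restrict_scalars ℝ).contDiffWithinAt
  · filter_upwards [cdf.eventually_apply_eq_iff_implicitFunction (by simp) hinv] with q hq hq0
    exact hq.1 (by rw [show f q = 0 from hq0, show f (a₀, μ) = 0 from h0])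

end RootContinuity

/-! ### Jordan structure when eigenspaces are one-dimensional -/

section JordanStructure

open Polynomial Module

variable {W : Type*} [AddCommGroup W] [Module ℂ W] [FiniteDimensional ℂ W]

omit [FiniteDimensional ℂ W] in
theorem ker_sub_pow_eq_genEigenspace (A : End ℂ W) (μ : ℂ) (k : ℕ) :
    LinearMap.ker ((A - algebraMap ℂ (End ℂ W) μ) ^ k) = A.genEigenspace μ k := by
  rw [Module.End.genEigenspace_nat, Algebra.algebraMap_eq_smul_one]

/-- `(A - μ)^k` maps the larger kernel into the eigenspace, which is a line, with the smaller kernel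
as its own kernel; rank–nullity concludes. -/
theorem kerDim_succ_le {A : End ℂ W} {μ : ℂ} (h1 : finrank ℂ (A.eigenspace μ) = 1) (k : ℕ) :
    kerDim A μ (k + 1) ≤ kerDim A μ k + 1 := by
  set N := A - algebraMap ℂ (End ℂ W) μ with hN
  have hrn := ((N ^ k).domRestrict (LinearMap.ker (N ^ (k + 1)))).finrank_range_add_finrank_ker
  have hker : finrank ℂ (LinearMap.ker ((N ^ k).domRestrict (LinearMap.ker (N ^ (k + 1))))) ≤
      kerDim A μ k := by
    rw [LinearMap.ker_domRestrict]
    exact (Submodule.comapSubtypeEquivOfLe (p := LinearMap.ker (N ^ k))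
      (q := LinearMap.ker (N ^ (k + 1))) (fun x hx ↦ by
        rw [LinearMap.mem_ker] at hx ⊢
        rw [pow_succ', Module.End.mul_apply, hx, map_zero])).finrank_eq.le
  have hrange : finrank ℂ (LinearMap.range ((N ^ k).domRestrict (LinearMap.ker (N ^ (k + 1))))) ≤
      1 := by
    refine (Submodule.finrank_mono ?_).trans h1.le
    rintro _ ⟨⟨x, hx⟩, rfl⟩
    rw [LinearMap.mem_ker, pow_succ', Module.End.mul_apply] at hx
    rw [Module.End.eigenspace_def, LinearMap.mem_ker, ← Algebra.algebraMap_eq_smul_one]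
    exact hx
  have : kerDim A μ (k + 1) = finrank ℂ (LinearMap.ker (N ^ (k + 1))) := rfl
  omega

theorem kerDim_le_rootMultiplicity (A : End ℂ W) (μ : ℂ) (k : ℕ) :
    kerDim A μ k ≤ A.charpoly.rootMultiplicity μ := by
  rw [kerDim, ker_sub_pow_eq_genEigenspace]
  exact A.finrank_genEigenspace_le μ k

theorem kerDim_eq_rootMultiplicity_of_stable {A : End ℂ W} {μ : ℂ} {k : ℕ}
    (h : kerDim A μ (k + 1) = kerDim A μ k) :
    kerDim A μ k = A.charpoly.rootMultiplicity μ := by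
  set N := A - algebraMap ℂ (End ℂ W) μ with hN
  have hle : LinearMap.ker (N ^ k) ≤ LinearMap.ker (N ^ k.succ) := fun x hx ↦ by
    rw [LinearMap.mem_ker] at hx ⊢
    rw [pow_succ', Module.End.mul_apply, hx, map_zero]
  have heq : LinearMap.ker (N ^ k) = LinearMap.ker (N ^ k.succ) :=
    Submodule.eq_of_le_of_finrank_eq hle h.symm
  have hstab := Module.End.ker_pow_constant heq (finrank ℂ W)
  refine le_antisymm (kerDim_le_rootMultiplicity A μ k) ?_
  rw [← A.finrank_maxGenEigenspace_eq, Module.End.maxGenEigenspace_eq_genEigenspace_finrank,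
    ← ker_sub_pow_eq_genEigenspace, kerDim, hstab, ker_sub_pow_eq_genEigenspace,
    ker_sub_pow_eq_genEigenspace]
  exact Submodule.finrank_mono (A.genEigenspace μ |>.monotone (by simp))

/-- The kernels grow by at most one dimension at each step, and once they stop growing they already
have the dimension of the generalized eigenspace. -/
theorem kerDim_eq_min {A : End ℂ W} {μ : ℂ} (h1 : finrank ℂ (A.eigenspace μ) = 1) (k : ℕ) :
    kerDim A μ k = min k (A.charpoly.rootMultiplicity μ) := by
  induction k with
  | zero => simp [kerDim, Module.End.one_eq_id, LinearMap.ker_id]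
  | succ k ih =>
    have hle := kerDim_succ_le h1 k
    have hm := kerDim_le_rootMultiplicity A μ (k + 1)
    have hge : kerDim A μ k ≤ kerDim A μ (k + 1) := by
      rw [kerDim, kerDim, ker_sub_pow_eq_genEigenspace, ker_sub_pow_eq_genEigenspace]
      exact Submodule.finrank_mono (A.genEigenspace μ |>.monotone (by simp))
    by_cases h : kerDim A μ (k + 1) = kerDim A μ k
    · have := kerDim_eq_rootMultiplicity_of_stable h
      omega
    · omega

theorem jordanBlockSizes_eq_singleton {A : End ℂ W} {μ : ℂ}
    (h1 : finrank ℂ (A.eigenspace μ) = 1) :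
    jordanBlockSizes A μ = {A.charpoly.rootMultiplicity μ} := by
  set m := A.charpoly.rootMultiplicity μ with hm
  have hpos : 1 ≤ m := h1 ▸ A.finrank_eigenspace_le μ
  have hle : m ≤ finrank ℂ W := by
    rw [hm, ← A.finrank_maxGenEigenspace_eq]
    exact Submodule.finrank_le _
  rw [jordanBlockSizes, Finset.sum_eq_single_of_mem m (Finset.mem_Icc.2 ⟨hpos, hle⟩)]
  · have : jordanBlockCount A μ m = 1 := by
      simp only [jordanBlockCount, kerDim_eq_min h1, ← hm]
      omega
    rw [this, Multiset.replicate_one]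
  · intro k hk hne
    have : jordanBlockCount A μ k = 0 := by
      rw [Finset.mem_Icc] at hk
      simp only [jordanBlockCount, kerDim_eq_min h1, ← hm]
      omega
    rw [this, Multiset.replicate_zero]

theorem mem_roots_charpoly_iff {A : End ℂ W} {μ : ℂ} :
    μ ∈ A.charpoly.roots ↔ A.HasEigenvalue μ := by
  rw [mem_roots A.charpoly_monic.ne_zero, Module.End.hasEigenvalue_iff_isRoot_charpoly]

theorem card_segreCharacteristic (A : End ℂ W) :
    (segreCharacteristic A).card = A.charpoly.roots.toFinset.card := by
  classical
  rw [segreCharacteristic, Multiset.card_map, Finset.card_def, Multiset.toFinset_val]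

/-- For an operator with one-dimensional eigenspaces, the Segre characteristic only remembers the
algebraic multiplicities. -/
theorem segreCharacteristic_eq {A : End ℂ W}
    (h : ∀ μ, A.HasEigenvalue μ → finrank ℂ (A.eigenspace μ) = 1) :
    segreCharacteristic A =
      A.charpoly.roots.toFinset.val.map fun μ ↦ {A.charpoly.rootMultiplicity μ} := by
  classical
  rw [segreCharacteristic, Multiset.toFinset_val]
  convert Multiset.map_congr rfl fun μ hμ ↦ ?_
  refine jordanBlockSizes_eq_singleton (h μ ?_)
  rw [← mem_roots_charpoly_iff]
  simpa using hμ

/-- Cayley–Hamilton: multiplying by `A - μ` restores the characteristic polynomial of `A`. -/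
theorem aeval_divByMonic_mem_eigenspace {A : End ℂ W} {μ : ℂ} (hμ : A.HasEigenvalue μ) (w : W) :
    aeval A (A.charpoly /ₘ (X - C μ)) w ∈ A.eigenspace μ := by
  have hroot := (Module.End.hasEigenvalue_iff_isRoot_charpoly A μ).1 hμ
  have h : (aeval A (X - C μ) * aeval A (A.charpoly /ₘ (X - C μ))) w = 0 := by
    rw [← map_mul, mul_divByMonic_eq_iff_isRoot.2 hroot, LinearMap.aeval_self_charpoly]
    rfl
  rw [Module.End.mem_eigenspace_iff, ← sub_eq_zero]
  simpa using h

/-- For an operator with one-dimensional eigenspaces, the complementary factor of an eigenvalue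
maps the generalized eigenspace onto the eigenspace. -/
theorem exists_aeval_divByMonic_eq {A : End ℂ W} {μ : ℂ} {v : W}
    (h1 : finrank ℂ (A.eigenspace μ) = 1) (hv : A.HasEigenvector μ v) :
    ∃ w, aeval A ((X - C μ) ^ A.charpoly.rootMultiplicity μ) w = 0 ∧
      aeval A (A.charpoly /ₘ (X - C μ)) w = v := by
  set m := A.charpoly.rootMultiplicity μ with hm
  set g := A.charpoly /ₘ (X - C μ) ^ m with hg
  have hpos : 1 ≤ m := h1 ▸ A.finrank_eigenspace_le μ
  obtain ⟨k, hk⟩ : ∃ k, m = k + 1 := ⟨m - 1, by omega⟩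
  have hfac : (X - C μ) ^ m * g = A.charpoly := pow_mul_divByMonic_rootMultiplicity_eq _ μ
  have hquot : A.charpoly /ₘ (X - C μ) = g * (X - C μ) ^ k := by
    have hne : (X - C μ) ≠ 0 := X_sub_C_ne_zero μ
    refine mul_left_cancel₀ hne ?_
    rw [mul_divByMonic_eq_iff_isRoot.2
      ((Module.End.hasEigenvalue_iff_isRoot_charpoly A μ).1
        (Module.End.hasEigenvalue_of_hasEigenvector hv)), ← hfac, hk]
    ring
  have haev : ∀ j, aeval A ((X - C μ) ^ j) = (A - algebraMap ℂ (End ℂ W) μ) ^ j := by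
    simp
  -- The vector `w` is the top of the single Jordan chain of length `m`; the power `k = m - 1` sends
  -- it to a nonzero eigenvector `u`.
  obtain ⟨w, hw, hw'⟩ : ∃ w ∈ LinearMap.ker (aeval A ((X - C μ) ^ m)),
      w ∉ LinearMap.ker (aeval A ((X - C μ) ^ k)) := by
    by_contra! hsub
    have hle := Submodule.finrank_mono (R := ℂ) (show LinearMap.ker (aeval A ((X - C μ) ^ m)) ≤
      LinearMap.ker (aeval A ((X - C μ) ^ k)) from hsub)
    rw [haev, haev] at hle
    have h2 : kerDim A μ m ≤ kerDim A μ k := hle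
    rw [kerDim_eq_min h1, kerDim_eq_min h1, ← hm] at h2
    omega
  rw [LinearMap.mem_ker] at hw hw'
  set u := aeval A ((X - C μ) ^ k) w with hu
  have hueig : A.HasEigenvector μ u := by
    refine ⟨?_, hw'⟩
    have : (aeval A (X - C μ) * aeval A ((X - C μ) ^ k)) w = 0 := by
      rw [← map_mul, ← pow_succ', ← hk, hw]
    rw [Module.End.mem_eigenspace_iff, ← sub_eq_zero]
    simpa [hu] using this
  have hgμ : g.eval μ ≠ 0 :=
    eval_divByMonic_pow_rootMultiplicity_ne_zero μ A.charpoly_monic.ne_zero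
  obtain ⟨c, hc⟩ : ∃ c : ℂ, c • u = v := by
    obtain ⟨c, hc⟩ := exists_smul_eq_of_finrank_eq_one h1 (x := ⟨u, hueig.1⟩)
      (by simpa using hueig.2) ⟨v, hv.1⟩
    exact ⟨c, congrArg Subtype.val hc⟩
  -- The remaining factor `g` acts on `u` as the nonzero scalar `g(μ)`, which the rescaling cancels.
  refine ⟨(c / g.eval μ) • w, by rw [map_smul, hw, smul_zero], ?_⟩
  rw [hquot, map_mul, Module.End.mul_apply, map_smul, ← hu, map_smul,
    Module.End.aeval_apply_of_hasEigenvector hueig, smul_smul, div_mul_cancel₀ _ hgμ, hc]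

end JordanStructure

/-! ### Smoothness of the characteristic coefficients and eigenvalues -/

section Smoothness

open Polynomial Module

theorem contDiff_mvPolynomial_eval {ι : Type*} [Fintype ι] (q : MvPolynomial ι ℝ) :
    ContDiff ℝ ∞ (fun a : ι → ℝ ↦ MvPolynomial.eval a q) := by
  induction q using MvPolynomial.induction_on with
  | C r => simpa using contDiff_const
  | add q r hq hr => simpa using hq.add hr
  | mul_X q i hq => simpa using hq.mul (contDiff_apply ℝ ℝ i)

/-- In a basis of the endomorphism space each coefficient is a polynomial in the coordinates. -/
theorem contDiff_charpoly_coeff {E : Type*} [NormedAddCommGroup E] [NormedSpace ℝ E]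
    [FiniteDimensional ℝ E] (k : ℕ) :
    ContDiff ℝ ∞ (fun A : E →L[ℝ] E ↦ A.toLinearMap.charpoly.coeff k) := by
  set b := finBasis ℝ (E →L[ℝ] E)
  have h : ∀ A : E →L[ℝ] E, A.toLinearMap.charpoly.coeff k =
      MvPolynomial.eval (b.equivFun A)
        (((ContinuousLinearMap.coeLM ℝ : (E →L[ℝ] E) →ₗ[ℝ] E →ₗ[ℝ] E).polyCharpoly b).coeff k) :=
    fun A ↦ (LinearMap.polyCharpoly_coeff_eval
      (φ := (ContinuousLinearMap.coeLM ℝ : (E →L[ℝ] E) →ₗ[ℝ] E →ₗ[ℝ] E)) b A k).symm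
  simp_rw [h]
  exact (contDiff_mvPolynomial_eval _).comp
    b.equivFun.toContinuousLinearEquiv.contDiff

variable {n : ℕ} {M : Type*} [TopologicalSpace M] [ChartedSpace (EuclideanSpace ℝ (Fin n)) M]
  [IsManifold (𝓡 n) ∞ M] {K : EndField n M} {p : M}

/-- The endomorphism field `K` read in the trivialization of the tangent bundle at `p`. -/
def coordEnd (K : EndField n M) (p x : M) :
    EuclideanSpace ℝ (Fin n) →L[ℝ] EuclideanSpace ℝ (Fin n) :=
  ContinuousLinearMap.inCoordinates (EuclideanSpace ℝ (Fin n))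
    (fun x : M ↦ TangentSpace (𝓡 n) x) (EuclideanSpace ℝ (Fin n))
    (fun x : M ↦ TangentSpace (𝓡 n) x) p x p x (K x)

/-- The trivialization of the tangent bundle at `p` over the point `x`. -/
def coordEquiv {p x : M} (hx : x ∈ (chartAt (EuclideanSpace ℝ (Fin n)) p).source) :
    TangentSpace (𝓡 n) x ≃L[ℝ] EuclideanSpace ℝ (Fin n) :=
  (trivializationAt (EuclideanSpace ℝ (Fin n)) (fun x : M ↦ TangentSpace (𝓡 n) x)
    p).continuousLinearEquivAt ℝ x hx

theorem coordEnd_eq {x : M} (hx : x ∈ (chartAt (EuclideanSpace ℝ (Fin n)) p).source) :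
    (coordEnd K p x).toLinearMap = (coordEquiv hx).toLinearEquiv.conj (K x).toLinearMap := by
  ext1 v
  rw [coordEnd, ContinuousLinearMap.inCoordinates_eq hx hx]
  rfl

theorem contMDiffAt_coordEnd (hK : IsSmooth K) (p : M) :
    ContMDiffAt (𝓡 n) 𝓘(ℝ, EuclideanSpace ℝ (Fin n) →L[ℝ] EuclideanSpace ℝ (Fin n)) ∞
      (coordEnd K p) p :=
  ((contMDiffAt_hom_bundle _).1 (hK p)).2

theorem contMDiff_charpoly_coeff (hK : IsSmooth K) (k : ℕ) :
    ContMDiff (𝓡 n) 𝓘(ℝ, ℝ) ∞ (fun x ↦ (K x).toLinearMap.charpoly.coeff k) := by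
  intro p
  have h : ContMDiffAt (𝓡 n) 𝓘(ℝ, ℝ) ∞
      (fun x ↦ (coordEnd K p x).toLinearMap.charpoly.coeff k) p :=
    (contDiff_charpoly_coeff k).contDiffAt.contMDiffAt.comp p (contMDiffAt_coordEnd hK p)
  refine h.congr_of_eventuallyEq ?_
  filter_upwards [(chartAt (EuclideanSpace ℝ (Fin n)) p).open_source.mem_nhds
    (mem_chart_source _ p)] with x hx
  rw [coordEnd_eq hx, LinearEquiv.charpoly_conj]

theorem contMDiff_sigma (hK : IsSmooth K) (j : ℕ) :
    ContMDiff (𝓡 n) 𝓘(ℝ, ℝ) ∞ (sigma K j) :=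
  (contMDiff_charpoly_coeff hK (n - j)).neg

omit [IsManifold (𝓡 n) ∞ M] in
theorem charpoly_complexify (x : M) :
    (complexify K x).charpoly = (K x).toLinearMap.charpoly.map (algebraMap ℝ ℂ) :=
  LinearMap.charpoly_baseChange ..

omit [IsManifold (𝓡 n) ∞ M] in
theorem natDegree_charpoly_complexify (x : M) : (complexify K x).charpoly.natDegree = n := by
  rw [LinearMap.charpoly_natDegree, Module.finrank_baseChange]
  exact finrank_euclideanSpace_fin

theorem contMDiff_charpoly_complexify_coeff (hK : IsSmooth K) (k : ℕ) :
    ContMDiff (𝓡 n) 𝓘(ℝ, ℂ) ∞ (fun x ↦ (complexify K x).charpoly.coeff k) := by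
  simp_rw [charpoly_complexify, coeff_map]
  exact Complex.ofRealCLM.contDiff.contMDiff.comp (contMDiff_charpoly_coeff hK k)

theorem continuous_charpoly_complexify_coeff (hK : IsSmooth K) (k : ℕ) :
    Continuous (fun x ↦ (complexify K x).charpoly.coeff k) :=
  (contMDiff_charpoly_complexify_coeff hK k).continuous

omit [IsManifold (𝓡 n) ∞ M] in
theorem IsAlgebraicallyGeneric.eventually_card_eq (h : IsAlgebraicallyGeneric K p) :
    ∀ᶠ x in 𝓝 p, (complexify K x).charpoly.roots.toFinset.card =
      (complexify K p).charpoly.roots.toFinset.card := by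
  filter_upwards [h] with x hx
  rw [← card_segreCharacteristic, hx, card_segreCharacteristic]

/-- A root of the characteristic polynomial extends smoothly as a zero of the iterated derivative
of which it is a simple zero. -/
theorem exists_contMDiffOn_root (hK : IsSmooth K) {μ : ℂ}
    (hμ : (complexify K p).charpoly.IsRoot μ) :
    ∃ ψ : M → ℂ, ψ p = μ ∧ (∃ U : Set M, IsOpen U ∧ p ∈ U ∧ ContMDiffOn (𝓡 n) 𝓘(ℝ, ℂ) ∞ ψ U) ∧
      ∀ᶠ q : M × ℂ in 𝓝 (p, μ),
        (complexify K q.1).charpoly.rootMultiplicity q.2 =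
          (complexify K p).charpoly.rootMultiplicity μ → ψ q.1 = q.2 := by
  set P : M → ℂ[X] := fun x ↦ (complexify K x).charpoly with hP
  have hne : ∀ x, P x ≠ 0 := fun x ↦ (LinearMap.charpoly_monic _).ne_zero
  -- A root of multiplicity `m + 1` is a simple zero of the `m`-th derivative, so the implicit
  -- function theorem applies there; nearby roots of the same multiplicity are zeros of that
  -- derivative too.
  obtain ⟨m, hm⟩ : ∃ m, (P p).rootMultiplicity μ = m + 1 :=
    ⟨_, (Nat.succ_pred_eq_of_pos ((rootMultiplicity_pos (hne p)).2 hμ)).symm⟩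
  set a : M → Fin (n + 1) → ℂ := fun x k ↦ (P x).coeff k with ha
  have hPa : ∀ x, ofCoeffs (a x) = P x := fun x ↦
    ofCoeffs_coeff (by rw [hP, natDegree_charpoly_complexify]; exact Nat.lt_succ_self n)
  have hasm : ContMDiff (𝓡 n) 𝓘(ℝ, Fin (n + 1) → ℂ) ∞ a :=
    contMDiff_pi_space.2 fun k ↦ contMDiff_charpoly_complexify_coeff hK k
  have h0 : (derivative^[m] (ofCoeffs (a p))).eval μ = 0 := by
    rw [hPa]
    exact isRoot_iterate_derivative_of_lt_rootMultiplicity (by omega)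
  have h1 : (derivative^[m + 1] (ofCoeffs (a p))).eval μ ≠ 0 := by
    rw [hPa]
    intro h
    have : m + 1 < (P p).rootMultiplicity μ := by
      refine (lt_rootMultiplicity_iff_isRoot_iterate_derivative (hne p)).2 fun k hk ↦ ?_
      rcases hk.lt_or_eq with hk | rfl
      · exact isRoot_iterate_derivative_of_lt_rootMultiplicity (by omega)
      · exact h
    omega
  obtain ⟨ψ, U, hU, hpU, hψ, hψp, hev⟩ := exists_contDiffOn_root h0 h1
  refine ⟨ψ ∘ a, hψp, ⟨a ⁻¹' U, hU.preimage hasm.continuous, hpU,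
    hψ.contMDiffOn.comp hasm.contMDiffOn fun _ hx ↦ hx⟩, ?_⟩
  have hcont : Filter.Tendsto (fun q : M × ℂ ↦ (a q.1, q.2)) (𝓝 (p, μ)) (𝓝 (a p, μ)) :=
    ((hasm.continuous.comp continuous_fst).prodMk continuous_snd).tendsto _
  filter_upwards [hcont.eventually hev] with q hq hmult
  refine hq ?_
  rw [hPa]
  refine isRoot_iterate_derivative_of_lt_rootMultiplicity ?_
  change m < (complexify K q.1).charpoly.rootMultiplicity q.2
  rw [hmult]
  change m < (P p).rootMultiplicity μ
  omega

/-- Near an algebraically generic point the characteristic polynomial splits into powers of linear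
factors with smooth roots. -/
theorem exists_smooth_factorization (hK : IsSmooth K) (hp : IsAlgebraicallyGeneric K p) :
    ∃ ψ : ℂ → M → ℂ, ∃ U : Set M, IsOpen U ∧ p ∈ U ∧
      (∀ μ ∈ (complexify K p).charpoly.roots.toFinset,
        ψ μ p = μ ∧ ContMDiffOn (𝓡 n) 𝓘(ℝ, ℂ) ∞ (ψ μ) U) ∧
      ∀ x ∈ U, (complexify K x).charpoly =
        ∏ μ ∈ (complexify K p).charpoly.roots.toFinset,
          (X - C (ψ μ x)) ^ (complexify K p).charpoly.rootMultiplicity μ := by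
  set s := (complexify K p).charpoly.roots.toFinset with hs
  have hroot : ∀ μ ∈ s, (complexify K p).charpoly.IsRoot μ := fun μ hμ ↦
    isRoot_of_mem_roots (Multiset.mem_toFinset.1 hμ)
  have hex := fun μ (hμ : (complexify K p).charpoly.IsRoot μ) ↦ exists_contMDiffOn_root hK hμ
  choose! ψ hψp hψ hψu using hex
  have hbij := eventually_exists_root_bijOn (P := fun x ↦ (complexify K x).charpoly)
    (S := fun μ x t ↦ (complexify K x).charpoly.rootMultiplicity t =
      (complexify K p).charpoly.rootMultiplicity μ → ψ μ x = t)
    (fun x ↦ LinearMap.charpoly_monic _) (fun x ↦ natDegree_charpoly_complexify x)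
    (fun k ↦ (continuous_charpoly_complexify_coeff hK k).continuousAt)
    hp.eventually_card_eq hψu
  have hsm : ∀ᶠ x in 𝓝 p, ∀ μ ∈ s, ∃ V ∈ 𝓝 x, ContMDiffOn (𝓡 n) 𝓘(ℝ, ℂ) ∞ (ψ μ) V := by
    refine (Filter.eventually_all_finset _).2 fun μ hμ ↦ ?_
    obtain ⟨V, hV, hpV, hc⟩ := hψ μ (hroot μ hμ)
    filter_upwards [hV.mem_nhds hpV] with x hx
    exact ⟨V, hV.mem_nhds hx, hc⟩
  obtain ⟨U, hU, hUo, hpU⟩ := eventually_nhds_iff.1 (hbij.and hsm)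
  refine ⟨ψ, U, hUo, hpU, fun μ hμ ↦ ⟨hψp μ (hroot μ hμ), fun x hx ↦ ?_⟩, fun x hx ↦ ?_⟩
  · obtain ⟨V, hV, hc⟩ := (hU x hx).2 μ hμ
    exact (hc.contMDiffAt hV).contMDiffWithinAt
  · obtain ⟨⟨r, hr, hrm⟩, -⟩ := hU x hx
    have hsp := (IsAlgClosed.splits (complexify K x).charpoly).eq_prod_roots_of_monic
      (LinearMap.charpoly_monic _)
    rw [prod_multiset_root_eq_finset_root] at hsp
    rw [hsp]
    symm
    refine Finset.prod_bij (fun μ _ ↦ r μ) (fun μ hμ ↦ hr.mapsTo hμ)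
      (fun μ hμ ν hν h ↦ hr.injOn hμ hν h) (fun t ht ↦ ?_) fun μ hμ ↦ ?_
    · obtain ⟨μ, hμ, h⟩ := hr.surjOn ht
      exact ⟨μ, hμ, h⟩
    · obtain ⟨h1, h2⟩ := hrm μ hμ
      rw [h2 h1, h1]

end Smoothness

/-! ### Differentiating curves of polynomials coefficientwise -/

section CoefficientDerivative

open Polynomial

/-- The curve of polynomials `P` is differentiable at `τ`, coefficient by coefficient, with
derivative `P'`. -/
def HasCoeffDerivAt (P : ℝ → ℂ[X]) (P' : ℂ[X]) (τ : ℝ) : Prop :=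
  ∀ k, HasDerivAt (fun t ↦ (P t).coeff k) (P'.coeff k) τ

variable {P Q : ℝ → ℂ[X]} {P' Q' : ℂ[X]} {τ : ℝ}

theorem HasCoeffDerivAt.mul (hP : HasCoeffDerivAt P P' τ) (hQ : HasCoeffDerivAt Q Q' τ) :
    HasCoeffDerivAt (fun t ↦ P t * Q t) (P' * Q τ + P τ * Q') τ := by
  intro k
  simp only [coeff_mul, coeff_add, ← Finset.sum_add_distrib]
  exact HasDerivAt.fun_sum fun i _ ↦ (hP i.1).mul (hQ i.2)

theorem HasCoeffDerivAt.pow (hP : HasCoeffDerivAt P P' τ) (m : ℕ) :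
    HasCoeffDerivAt (fun t ↦ P t ^ m) (m * P τ ^ (m - 1) * P') τ := by
  induction m with
  | zero =>
    intro k
    simpa using hasDerivAt_const τ _
  | succ m ih =>
    have h := ih.mul hP
    simp only [← pow_succ] at h
    convert h using 1
    cases m with
    | zero => simp
    | succ m =>
      push_cast
      ring

theorem HasCoeffDerivAt.finset_prod {ι : Type*} [DecidableEq ι] {s : Finset ι}
    {P : ι → ℝ → ℂ[X]} {P' : ι → ℂ[X]} (hP : ∀ i ∈ s, HasCoeffDerivAt (P i) (P' i) τ) :
    HasCoeffDerivAt (fun t ↦ ∏ i ∈ s, P i t) (∑ i ∈ s, (∏ j ∈ s.erase i, P j τ) * P' i) τ := by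
  induction s using Finset.induction_on with
  | empty =>
    intro k
    simpa using hasDerivAt_const τ _
  | insert a s ha ih =>
    have h := (hP a (Finset.mem_insert_self a s)).mul
      (ih fun i hi ↦ hP i (Finset.mem_insert_of_mem hi))
    convert h using 1
    · exact funext fun t ↦ Finset.prod_insert ha
    rw [Finset.sum_insert ha, Finset.erase_insert ha, mul_comm, Finset.mul_sum]
    congr 1
    refine Finset.sum_congr rfl fun i hi ↦ ?_
    rw [Finset.erase_insert_of_ne (by rintro rfl; exact ha hi),
      Finset.prod_insert (fun h ↦ ha (Finset.mem_of_mem_erase h)), mul_assoc]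

theorem hasCoeffDerivAt_X_sub_C {f : ℝ → ℂ} {f' : ℂ} (hf : HasDerivAt f f' τ) :
    HasCoeffDerivAt (fun t ↦ X - C (f t)) (-C f') τ := by
  intro k
  cases k with
  | zero => simpa using! hf.neg
  | succ k => simpa [coeff_C] using hasDerivAt_const τ _

/-- The derivative of a product of powers of linear factors with moving roots. -/
theorem hasCoeffDerivAt_prod_X_sub_C_pow {s : Finset ℂ} {m : ℂ → ℕ} {ψ : ℂ → ℝ → ℂ} {ψ' : ℂ → ℂ}
    (hm : ∀ μ ∈ s, m μ ≠ 0) (hψτ : ∀ μ ∈ s, ψ μ τ = μ)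
    (hψ : ∀ μ ∈ s, HasDerivAt (ψ μ) (ψ' μ) τ) :
    HasCoeffDerivAt (fun t ↦ ∏ μ ∈ s, (X - C (ψ μ t)) ^ m μ)
      (-∑ μ ∈ s, C (m μ * ψ' μ) * ((∏ ν ∈ s, (X - C ν) ^ m ν) /ₘ (X - C μ))) τ := by
  have h := HasCoeffDerivAt.finset_prod (τ := τ) (s := s)
    (P := fun μ t ↦ (X - C (ψ μ t)) ^ m μ)
    fun μ hμ ↦ (hasCoeffDerivAt_X_sub_C (hψ μ hμ)).pow (m μ)
  convert h using 1
  rw [← Finset.sum_neg_distrib]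
  refine Finset.sum_congr rfl fun μ hμ ↦ ?_
  have hfac : ∏ ν ∈ s, (X - C ν) ^ m ν =
      (X - C μ) * ((∏ ν ∈ s.erase μ, (X - C ν) ^ m ν) * (X - C μ) ^ (m μ - 1)) := by
    -- Exposing one factor `X - C μ` makes the division explicit; this requires `m μ ≠ 0`.
    rw [← Finset.prod_erase_mul s _ hμ]
    have : (X - C μ) ^ m μ = (X - C μ) * (X - C μ) ^ (m μ - 1) := by
      rw [← pow_succ', Nat.sub_add_cancel (Nat.one_le_iff_ne_zero.2 (hm μ hμ))]
    rw [this]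
    ring
  have hprod : ∏ ν ∈ s.erase μ, (X - C (ψ ν τ)) ^ m ν = ∏ ν ∈ s.erase μ, (X - C ν) ^ m ν :=
    Finset.prod_congr rfl fun ν hν ↦ by rw [hψτ ν (Finset.mem_of_mem_erase hν)]
  rw [hfac, mul_divByMonic_cancel_left _ (monic_X_sub_C μ), hψτ μ hμ, hprod]
  simp only [C_mul, map_natCast]
  ring

end CoefficientDerivative

/-! ### The equivalence at an algebraically generic point -/

section Main

open Polynomial Module

variable {n : ℕ} {M : Type*} [TopologicalSpace M] [ChartedSpace (EuclideanSpace ℝ (Fin n)) M]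
  {K : EndField n M} {p : M}

/-- The curve through `p` that is straight, with velocity `v`, in the chart at `p`. -/
def chartCurve (p : M) (v : EuclideanSpace ℝ (Fin n)) (t : ℝ) : M :=
  (extChartAt (𝓡 n) p).symm (extChartAt (𝓡 n) p p + t • v)

theorem chartCurve_zero (p : M) (v : EuclideanSpace ℝ (Fin n)) : chartCurve p v 0 = p := by
  simp [chartCurve]

theorem hasDerivAt_line (p : M) (v : EuclideanSpace ℝ (Fin n)) :
    HasDerivAt (fun t : ℝ ↦ extChartAt (𝓡 n) p p + t • v) v 0 := by
  simpa using ((hasDerivAt_id (0 : ℝ)).smul_const v).const_add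
    (extChartAt (𝓡 n) p p)

theorem continuousAt_chartCurve (p : M) (v : EuclideanSpace ℝ (Fin n)) :
    ContinuousAt (chartCurve p v) 0 := by
  refine ContinuousAt.comp (g := (extChartAt (𝓡 n) p).symm) ?_ (hasDerivAt_line p v).continuousAt
  simpa using continuousAt_extChartAt_symm (I := 𝓡 n) p

theorem hasDerivAt_comp_chartCurve {F : Type*} [NormedAddCommGroup F] [NormedSpace ℝ F]
    {f : M → F} (hf : MDifferentiableAt (𝓡 n) 𝓘(ℝ, F) f p) (v : EuclideanSpace ℝ (Fin n)) :
    HasDerivAt (fun t ↦ f (chartCurve p v t)) (mfderiv (𝓡 n) 𝓘(ℝ, F) f p v : F) 0 := by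
  have h := hf.hasMFDerivAt.2
  rw [ModelWithCorners.range_eq_univ] at h
  replace h := h.hasFDerivAt Filter.univ_mem
  refine HasFDerivAt.comp_hasDerivAt_of_eq (0 : ℝ) h (hasDerivAt_line p v) ?_
  simp

variable [IsManifold (𝓡 n) ∞ M]

/-- Along a curve with velocity `v`, the coefficient can be differentiated directly or through the
factorization; uniqueness of derivatives equates the two results. The minus sign in `sigma` cancels
the one from moving the roots. -/
theorem ofReal_differential_sigma (hK : IsSmooth K) {ψ : ℂ → M → ℂ} {U : Set M} (hU : IsOpen U)
    (hpU : p ∈ U)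
    (hψ : ∀ μ ∈ (complexify K p).charpoly.roots.toFinset,
      ψ μ p = μ ∧ ContMDiffOn (𝓡 n) 𝓘(ℝ, ℂ) ∞ (ψ μ) U)
    (hfac : ∀ x ∈ U, (complexify K x).charpoly =
      ∏ μ ∈ (complexify K p).charpoly.roots.toFinset,
        (X - C (ψ μ x)) ^ (complexify K p).charpoly.rootMultiplicity μ)
    (j : ℕ) (v : TangentSpace (𝓡 n) p) :
    ((differential (sigma K j) p v : ℝ) : ℂ) =
      ∑ μ ∈ (complexify K p).charpoly.roots.toFinset,
        (complexify K p).charpoly.rootMultiplicity μ * complexDifferential (ψ μ) p (1 ⊗ₜ v) *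
          ((complexify K p).charpoly /ₘ (X - C μ)).coeff (n - j) := by
  set A := complexify K p with hA
  set γ := chartCurve p v with hγ
  have hγ0 : γ 0 = p := chartCurve_zero p v
  have hd1 : HasDerivAt (fun t ↦ ((sigma K j (γ t) : ℝ) : ℂ))
      ((differential (sigma K j) p v : ℝ) : ℂ) 0 :=
    (hasDerivAt_comp_chartCurve (((contMDiff_sigma hK j) p).mdifferentiableAt (by simp))
      v).ofReal_comp
  have hd2 := hasCoeffDerivAt_prod_X_sub_C_pow (τ := 0) (s := A.charpoly.roots.toFinset)
    (m := fun μ ↦ A.charpoly.rootMultiplicity μ) (ψ := fun μ t ↦ ψ μ (γ t))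
    (ψ' := fun μ ↦ complexDifferential (ψ μ) p (1 ⊗ₜ v))
    (fun μ hμ ↦ ((rootMultiplicity_pos A.charpoly_monic.ne_zero).2
      (isRoot_of_mem_roots (Multiset.mem_toFinset.1 hμ))).ne')
    (fun μ hμ ↦ by rw [hγ0]; exact (hψ μ hμ).1)
    (fun μ hμ ↦ by
      have h := hasDerivAt_comp_chartCurve
        (((hψ μ hμ).2.contMDiffAt (hU.mem_nhds hpU)).mdifferentiableAt (by simp)) v
      rw [complexDifferential, LinearMap.liftBaseChange_one_tmul]
      exact h)
  have hprod : ∏ ν ∈ A.charpoly.roots.toFinset, (X - C ν) ^ A.charpoly.rootMultiplicity ν =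
      A.charpoly :=
    (Finset.prod_congr rfl fun ν hν ↦ by rw [(hψ ν hν).1]).trans (hfac p hpU).symm
  rw [hprod] at hd2
  have hev : (fun t ↦ ((sigma K j (γ t) : ℝ) : ℂ)) =ᶠ[𝓝 0] fun t ↦
      -((∏ μ ∈ A.charpoly.roots.toFinset,
        (X - C (ψ μ (γ t))) ^ A.charpoly.rootMultiplicity μ).coeff (n - j)) := by
    have hc : ContinuousAt γ 0 := continuousAt_chartCurve p v
    filter_upwards [hc.preimage_mem_nhds (by rw [hγ0]; exact hU.mem_nhds hpU)] with t ht
    rw [← hfac _ ht, charpoly_complexify, coeff_map, sigma]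
    simp
  rw [hd1.unique ((hd2 (n - j)).neg.congr_of_eventuallyEq hev)]
  rw [coeff_neg, neg_neg, finsetSum_coeff]
  exact Finset.sum_congr rfl fun μ _ ↦ coeff_C_mul _

omit [IsManifold (𝓡 n) ∞ M] in
theorem dualOperator_pow_apply (k : ℕ) (α : Module.Dual ℝ (TangentSpace (𝓡 n) p))
    (v : TangentSpace (𝓡 n) p) :
    (dualOperator K p ^ k) α v = α (((K p).toLinearMap ^ k) v) := by
  induction k generalizing α with
  | zero => rfl
  | succ k ih =>
    rw [pow_succ, Module.End.mul_apply, ih, pow_succ', Module.End.mul_apply]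
    rfl

omit [IsManifold (𝓡 n) ∞ M] in
theorem sigmaForm_apply (v : TangentSpace (𝓡 n) p) :
    sigmaForm K p v =
      ∑ j ∈ Finset.Icc 1 n, differential (sigma K j) p (((K p).toLinearMap ^ (n - j)) v) := by
  simp only [sigmaForm, LinearMap.sum_apply, dualOperator_pow_apply]

omit [IsManifold (𝓡 n) ∞ M] in
theorem complexify_pow_one_tmul (k : ℕ) (v : TangentSpace (𝓡 n) p) :
    (complexify K p ^ k) (1 ⊗ₜ v) = 1 ⊗ₜ[ℝ] ((K p).toLinearMap ^ k) v := by
  rw [complexify, ← LinearMap.baseChange_pow, LinearMap.baseChange_tmul]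

/-- The complexification of `sigmaForm K p` in terms of the differentials of the eigenvalues. -/
theorem liftBaseChange_sigmaForm (hK : IsSmooth K) {ψ : ℂ → M → ℂ} {U : Set M} (hU : IsOpen U)
    (hpU : p ∈ U)
    (hψ : ∀ μ ∈ (complexify K p).charpoly.roots.toFinset,
      ψ μ p = μ ∧ ContMDiffOn (𝓡 n) 𝓘(ℝ, ℂ) ∞ (ψ μ) U)
    (hfac : ∀ x ∈ U, (complexify K x).charpoly =
      ∏ μ ∈ (complexify K p).charpoly.roots.toFinset,
        (X - C (ψ μ x)) ^ (complexify K p).charpoly.rootMultiplicity μ)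
    (w : ℂ ⊗[ℝ] TangentSpace (𝓡 n) p) :
    LinearMap.liftBaseChange ℂ (Complex.ofRealCLM.toLinearMap ∘ₗ sigmaForm K p) w =
      ∑ μ ∈ (complexify K p).charpoly.roots.toFinset,
        (complexify K p).charpoly.rootMultiplicity μ * complexDifferential (ψ μ) p
          (aeval (complexify K p) ((complexify K p).charpoly /ₘ (X - C μ)) w) := by
  set A := complexify K p with hA
  suffices h : LinearMap.liftBaseChange ℂ (Complex.ofRealCLM.toLinearMap ∘ₗ sigmaForm K p) =
      ∑ μ ∈ A.charpoly.roots.toFinset, (A.charpoly.rootMultiplicity μ : ℂ) •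
        (complexDifferential (ψ μ) p ∘ₗ aeval A (A.charpoly /ₘ (X - C μ))) by
    rw [h]
    simp
  -- Both sides are complex-linear, so it suffices to compare them on real vectors `1 ⊗ v`.
  refine TensorProduct.AlgebraTensorModule.curry_injective ?_
  ext v
  simp only [TensorProduct.AlgebraTensorModule.curry_apply, TensorProduct.curry_apply,
    LinearMap.coe_restrictScalars]
  rw [LinearMap.liftBaseChange_one_tmul]
  have hdeg : ∀ μ ∈ A.charpoly.roots.toFinset, (A.charpoly /ₘ (X - C μ)).natDegree < n := by
    intro μ hμ
    have hn : 0 < A.charpoly.natDegree := by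
      rw [(IsAlgClosed.splits A.charpoly).natDegree_eq_card_roots]
      exact Multiset.card_pos_iff_exists_mem.2 ⟨μ, Multiset.mem_toFinset.1 hμ⟩
    rw [natDegree_divByMonic _ (monic_X_sub_C μ), natDegree_X_sub_C]
    rw [hA, natDegree_charpoly_complexify] at hn ⊢
    omega
  have hleft : (Complex.ofRealCLM.toLinearMap ∘ₗ sigmaForm K p) v =
      ∑ k ∈ Finset.range n, ∑ μ ∈ A.charpoly.roots.toFinset,
        A.charpoly.rootMultiplicity μ *
          complexDifferential (ψ μ) p (1 ⊗ₜ ((K p).toLinearMap ^ k) v) *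
          (A.charpoly /ₘ (X - C μ)).coeff k := by
    change ((sigmaForm K p v : ℝ) : ℂ) = _
    rw [sigmaForm_apply, Complex.ofReal_sum]
    refine Finset.sum_nbij' (fun j ↦ n - j) (fun k ↦ n - k) ?_ ?_ ?_ ?_ fun j hj ↦
      ofReal_differential_sigma hK hU hpU hψ hfac j _
    all_goals
      intro j hj
      simp only [Finset.mem_Icc, Finset.mem_range] at hj ⊢
      omega
  rw [hleft, Finset.sum_comm, LinearMap.sum_apply]
  refine Finset.sum_congr rfl fun μ hμ ↦ ?_
  rw [LinearMap.smul_apply, LinearMap.comp_apply, aeval_eq_sum_range' (hdeg μ hμ),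
    LinearMap.sum_apply, map_sum, smul_eq_mul, Finset.mul_sum]
  refine Finset.sum_congr rfl fun k _ ↦ ?_
  rw [LinearMap.smul_apply, map_smul, complexify_pow_one_tmul, smul_eq_mul]
  ring

/-- The terms of `liftBaseChange_sigmaForm` vanish one by one under weak nonlinearity, and can be
isolated one by one on generalized eigenspaces. -/
theorem isWeaklyNonlinearAt_iff (hK : IsSmooth K) (hreg : IsGLRegular K)
    (hp : IsAlgebraicallyGeneric K p) : IsWeaklyNonlinearAt K p ↔ sigmaForm K p = 0 := by
  obtain ⟨ψ, U, hU, hpU, hψ, hfac⟩ := exists_smooth_factorization hK hp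
  have hform := liftBaseChange_sigmaForm hK hU hpU hψ hfac
  set A := complexify K p with hA
  have hmem : ∀ μ, μ ∈ A.charpoly.roots.toFinset ↔ A.HasEigenvalue μ := fun μ ↦ by
    rw [Multiset.mem_toFinset, mem_roots_charpoly_iff]
  have heigen : ∀ μ, A.HasEigenvalue μ → IsEigenvalueFunctionNear K p (ψ μ) := by
    intro μ hμ
    refine ⟨U, hU, hpU, (hψ μ ((hmem μ).2 hμ)).2, fun x hx ↦ ?_⟩
    rw [Module.End.hasEigenvalue_iff_isRoot_charpoly, hfac x hx, IsRoot, eval_prod]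
    refine Finset.prod_eq_zero ((hmem μ).2 hμ) ?_
    have hpos := (rootMultiplicity_pos A.charpoly_monic.ne_zero).2
      ((Module.End.hasEigenvalue_iff_isRoot_charpoly A μ).1 hμ)
    simp [hpos.ne']
  -- Near `p` the value `lam x` must be one of the `ψ ν x`, and continuity excludes `ν ≠ μ`. Thus
  -- only `ψ μ` has to be tested.
  have huniq : ∀ μ, A.HasEigenvalue μ → ∀ lam : M → ℂ, IsEigenvalueFunctionNear K p lam →
      lam p = μ → lam =ᶠ[𝓝 p] ψ μ := by
    rintro μ hμ lam ⟨V, hV, hpV, hlam, hlamV⟩ hlamp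
    have hne : ∀ᶠ x in 𝓝 p, ∀ ν ∈ A.charpoly.roots.toFinset, ν ≠ μ → lam x ≠ ψ ν x := by
      refine (Filter.eventually_all_finset _).2 fun ν hν ↦ ?_
      by_cases hνμ : ν = μ
      · exact Filter.Eventually.of_forall fun _ h ↦ absurd hνμ h
      · have h1 : ContinuousAt lam p := (hlam.contMDiffAt (hV.mem_nhds hpV)).continuousAt
        have h2 : ContinuousAt (ψ ν) p := ((hψ ν hν).2.contMDiffAt (hU.mem_nhds hpU)).continuousAt
        have h3 : ∀ᶠ x in 𝓝 p, lam x - ψ ν x ≠ 0 :=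
          (h1.sub h2).eventually_ne (by
            rw [Pi.sub_apply, hlamp, (hψ ν hν).1]
            exact sub_ne_zero.2 (Ne.symm hνμ))
        filter_upwards [h3] with x hx _
        exact sub_ne_zero.1 hx
    filter_upwards [hU.mem_nhds hpU, hV.mem_nhds hpV, hne] with x hxU hxV hx
    have hroot := (Module.End.hasEigenvalue_iff_isRoot_charpoly _ _).1 (hlamV x hxV)
    rw [hfac x hxU, IsRoot, eval_prod, Finset.prod_eq_zero_iff] at hroot
    obtain ⟨ν, hν, h0⟩ := hroot
    have h0' : lam x = ψ ν x := by
      rw [eval_pow] at h0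
      simpa [sub_eq_zero] using eq_zero_of_pow_eq_zero h0
    by_cases hνμ : ν = μ
    · rw [h0', hνμ]
    · exact absurd h0' (hx ν hν hνμ)
  constructor
  · intro hw
    have hzero : LinearMap.liftBaseChange ℂ
        (Complex.ofRealCLM.toLinearMap ∘ₗ sigmaForm K p) = 0 := by
      refine LinearMap.ext fun w ↦ ?_
      rw [hform w, LinearMap.zero_apply]
      refine Finset.sum_eq_zero fun μ hμ ↦ mul_eq_zero_of_right _ ?_
      have hev := (hmem μ).1 hμ
      by_cases hv : aeval A (A.charpoly /ₘ (X - C μ)) w = 0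
      · rw [hv, map_zero]
      · exact (hw μ hev).2 (ψ μ) (heigen μ hev) (hψ μ hμ).1 _
          ⟨aeval_divByMonic_mem_eigenspace hev w, hv⟩
    ext1 v
    have h := LinearMap.congr_fun hzero (1 ⊗ₜ v)
    rw [LinearMap.liftBaseChange_one_tmul] at h
    exact Complex.ofReal_eq_zero.1 h
  · intro h0 μ hμ
    have hμs := (hmem μ).2 hμ
    refine ⟨⟨ψ μ, heigen μ hμ, (hψ μ hμs).1⟩, fun lam hlam hlamp v hv ↦ ?_⟩
    have hcd : (complexDifferential lam p : ℂ ⊗[ℝ] TangentSpace (𝓡 n) p →ₗ[ℂ] ℂ) =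
        complexDifferential (ψ μ) p := by
      rw [complexDifferential, (huniq μ hμ lam hlam hlamp).mfderiv_eq]
      rfl
    rw [hcd]
    obtain ⟨w, hw, hwv⟩ := exists_aeval_divByMonic_eq (hreg p μ hμ) hv
    have hsum := hform w
    have hzero : LinearMap.liftBaseChange ℂ
        (Complex.ofRealCLM.toLinearMap ∘ₗ sigmaForm K p) = 0 := by
      rw [h0, LinearMap.comp_zero]
      exact map_zero (LinearMap.liftBaseChangeEquiv ℂ)
    rw [hzero, LinearMap.zero_apply,
      Finset.sum_eq_single_of_mem μ hμs, hwv] at hsum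
    · have hpos := (rootMultiplicity_pos A.charpoly_monic.ne_zero).2
        ((Module.End.hasEigenvalue_iff_isRoot_charpoly A μ).1 hμ)
      exact (mul_eq_zero.1 hsum.symm).resolve_left (Nat.cast_ne_zero.2 hpos.ne')
    · intro ν hν hne
      -- Removing a factor `X - C ν` leaves the full power of `X - C μ`, which annihilates `w`.
      have hdvd : (X - C μ) ^ A.charpoly.rootMultiplicity μ ∣ A.charpoly /ₘ (X - C ν) := by
        have hroot : A.charpoly.IsRoot ν := isRoot_of_mem_roots (Multiset.mem_toFinset.1 hν)
        refine IsCoprime.dvd_of_dvd_mul_left (y := X - C ν) ?_ ?_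
        · exact IsCoprime.pow_left (isCoprime_X_sub_C_of_isUnit_sub
            (sub_ne_zero.2 (Ne.symm hne)).isUnit)
        · rw [mul_divByMonic_eq_iff_isRoot.2 hroot]
          exact pow_rootMultiplicity_dvd _ _
      obtain ⟨g, hg⟩ := hdvd
      rw [hg, mul_comm _ g, map_mul, Module.End.mul_apply, hw, map_zero, map_zero, mul_zero]

end Main

/-! ### Density of generic points and closedness of the equation -/

section Global

open Polynomial Module

variable {n : ℕ} {M : Type*} [TopologicalSpace M] [ChartedSpace (EuclideanSpace ℝ (Fin n)) M]
  [IsManifold (𝓡 n) ∞ M] {K : EndField n M} {p : M}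

/-- A locally constant number of distinct roots gives a multiplicity-preserving bijection between
spectra, and gl-regularity reduces the Segre characteristic to these multiplicities. -/
theorem isAlgebraicallyGeneric_of_eventually_card_eq (hK : IsSmooth K) (hreg : IsGLRegular K)
    (h : ∀ᶠ x in 𝓝 p, (complexify K x).charpoly.roots.toFinset.card =
      (complexify K p).charpoly.roots.toFinset.card) : IsAlgebraicallyGeneric K p := by
  filter_upwards [eventually_exists_root_bijOn (P := fun x ↦ (complexify K x).charpoly)
    (S := fun _ _ _ ↦ True) (fun x ↦ LinearMap.charpoly_monic _)
    (fun x ↦ natDegree_charpoly_complexify x)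
    (fun k ↦ (continuous_charpoly_complexify_coeff hK k).continuousAt) h
    (fun _ _ ↦ Filter.Eventually.of_forall fun _ ↦ trivial)] with x ⟨r, hr, hrm⟩
  have himage : (complexify K x).charpoly.roots.toFinset =
      (complexify K p).charpoly.roots.toFinset.image r := by
    rw [← Finset.coe_inj, Finset.coe_image]
    exact hr.image_eq.symm
  rw [segreCharacteristic_eq (hreg x), segreCharacteristic_eq (hreg p), himage,
    Finset.image_val_of_injOn hr.injOn, Multiset.map_map]
  refine Multiset.map_congr rfl fun μ hμ ↦ ?_
  rw [Function.comp_apply, (hrm μ hμ).1]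

/-- Algebraically generic points are dense. -/
theorem dense_isAlgebraicallyGeneric (hK : IsSmooth K) (hreg : IsGLRegular K) :
    Dense {x | IsAlgebraicallyGeneric K x} := by
  intro p
  rw [mem_closure_iff]
  intro U hU hpU
  set c : M → ℕ := fun x ↦ (complexify K x).charpoly.roots.toFinset.card with hc
  have hcn : ∀ x, c x ≤ n := fun x ↦
    (Multiset.toFinset_card_le _).trans ((card_roots' _).trans
      (natDegree_charpoly_complexify x).le)
  -- Take a point of `U` with the most distinct eigenvalues; by lower semicontinuity the count is
  -- constant near it.
  obtain ⟨x, hxU, hmax⟩ := (measure fun x ↦ n - c x).wf.has_min U ⟨p, hpU⟩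
  refine ⟨x, hxU, isAlgebraicallyGeneric_of_eventually_card_eq hK hreg ?_⟩
  filter_upwards [hU.mem_nhds hxU,
    eventually_card_roots_le (P := fun x ↦ (complexify K x).charpoly) (p := x)
      (fun x ↦ LinearMap.charpoly_monic _) (fun x ↦ natDegree_charpoly_complexify x)
      (fun k ↦ (continuous_charpoly_complexify_coeff hK k).continuousAt)] with y hyU hy
  have h1 : ¬ (n - c y < n - c x) := hmax y hyU
  have h2 : c x ≤ c y := hy
  have h3 := hcn y
  change c y = c x
  omega

/-- The covector `sigmaForm K x` read in the chart at `p`. -/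
def coordSigmaForm (K : EndField n M) (p x : M) : EuclideanSpace ℝ (Fin n) →L[ℝ] ℝ :=
  ∑ j ∈ Finset.Icc 1 n,
    (fderiv ℝ (sigma K j ∘ (extChartAt (𝓡 n) p).symm) (extChartAt (𝓡 n) p x)).comp
      (coordEnd K p x ^ (n - j))

theorem contDiffOn_sigma_comp_symm (hK : IsSmooth K) (p : M) (j : ℕ) :
    ContDiffOn ℝ ∞ (sigma K j ∘ (extChartAt (𝓡 n) p).symm) (extChartAt (𝓡 n) p).target :=
  ((contMDiff_sigma hK j).comp_contMDiffOn (contMDiffOn_extChartAt_symm p)).contDiffOn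

theorem continuousAt_coordSigmaForm (hK : IsSmooth K) (p : M) :
    ContinuousAt (coordSigmaForm K p) p := by
  refine tendsto_finsetSum _ fun j _ ↦ ?_
  have h1 : ContinuousAt (fun x ↦
      fderiv ℝ (sigma K j ∘ (extChartAt (𝓡 n) p).symm) (extChartAt (𝓡 n) p x)) p := by
    have h := (contDiffOn_sigma_comp_symm hK p j).contDiffAt
      ((isOpen_extChartAt_target p).mem_nhds (mem_extChartAt_target p))
    exact ContinuousAt.comp (g := fderiv ℝ (sigma K j ∘ (extChartAt (𝓡 n) p).symm))
      (h.fderiv_right (m := 0) (by simp)).continuousAt (continuousAt_extChartAt p)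
  exact h1.clm_comp ((contMDiffAt_coordEnd hK p).continuousAt.pow (n - j))

/-- The tangent bundle trivialization at `p` is the derivative of the chart at `p`, so this is the
chain rule. -/
theorem differential_sigma_eq (hK : IsSmooth K) (j : ℕ) {x : M}
    (hx : x ∈ (chartAt (EuclideanSpace ℝ (Fin n)) p).source) (v : TangentSpace (𝓡 n) x) :
    differential (sigma K j) x v =
      fderiv ℝ (sigma K j ∘ (extChartAt (𝓡 n) p).symm) (extChartAt (𝓡 n) p x)
        (coordEquiv hx v) := by
  have : IsManifold (𝓡 n) 1 M := IsManifold.of_le (n := ∞) (by simp)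
  have hxs : x ∈ (extChartAt (𝓡 n) p).source := by rwa [extChartAt_source]
  have hC : coordEquiv hx v = mfderiv (𝓡 n) 𝓘(ℝ, EuclideanSpace ℝ (Fin n))
      (extChartAt (𝓡 n) p) x v := by
    rw [← TangentBundle.continuousLinearMapAt_trivializationAt hx]
    exact congrFun (Bundle.Trivialization.coe_continuousLinearEquivAt_eq _ hx) v
  have hd : DifferentiableAt ℝ (sigma K j ∘ (extChartAt (𝓡 n) p).symm)
      (extChartAt (𝓡 n) p x) :=
    ((contDiffOn_sigma_comp_symm hK p j).contDiffAt ((isOpen_extChartAt_target p).mem_nhds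
      ((extChartAt (𝓡 n) p).map_source hxs))).differentiableAt (by simp)
  have heq : sigma K j =ᶠ[𝓝 x]
      (sigma K j ∘ (extChartAt (𝓡 n) p).symm) ∘ extChartAt (𝓡 n) p := by
    filter_upwards [(isOpen_extChartAt_source p).mem_nhds hxs] with y hy
    simp only [Function.comp_apply, (extChartAt (𝓡 n) p).left_inv hy]
  rw [hC, differential, heq.mfderiv_eq (I := 𝓡 n) (I' := 𝓘(ℝ, ℝ)),
    mfderiv_comp (I' := 𝓘(ℝ, EuclideanSpace ℝ (Fin n))) x hd.mdifferentiableAt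
      (mdifferentiableAt_extChartAt hx), mfderiv_eq_fderiv]
  rfl

theorem coordEnd_pow_apply {x : M} (hx : x ∈ (chartAt (EuclideanSpace ℝ (Fin n)) p).source)
    (k : ℕ) (v : TangentSpace (𝓡 n) x) :
    (coordEnd K p x ^ k) (coordEquiv hx v) = coordEquiv hx (((K x).toLinearMap ^ k) v) := by
  induction k with
  | zero => rfl
  | succ k ih =>
    have h : ∀ w, coordEnd K p x (coordEquiv hx w) = coordEquiv hx (K x w) := fun w ↦ by
      have := LinearMap.congr_fun (coordEnd_eq (K := K) hx) (coordEquiv hx w)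
      simpa [LinearEquiv.conj_apply] using! this
    rw [pow_succ', pow_succ', mul_apply_eq_comp, ih, h]
    rfl

/-- The covectors at different points are moved to one fixed space, where continuity in `x` makes
nonvanishing an open condition. -/
theorem sigmaForm_eq_coordSigmaForm (hK : IsSmooth K) {x : M}
    (hx : x ∈ (chartAt (EuclideanSpace ℝ (Fin n)) p).source) (v : TangentSpace (𝓡 n) x) :
    sigmaForm K x v = coordSigmaForm K p x (coordEquiv hx v) := by
  rw [sigmaForm_apply, coordSigmaForm, sum_apply]
  refine Finset.sum_congr rfl fun j _ ↦ ?_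
  rw [ContinuousLinearMap.comp_apply, coordEnd_pow_apply, differential_sigma_eq hK j hx]

theorem sigmaForm_eq_zero_iff (hK : IsSmooth K) {x : M}
    (hx : x ∈ (chartAt (EuclideanSpace ℝ (Fin n)) p).source) :
    sigmaForm K x = 0 ↔ coordSigmaForm K p x = 0 := by
  constructor
  · intro h
    ext1 w
    have := sigmaForm_eq_coordSigmaForm hK hx ((coordEquiv hx).symm w)
    rw [h, (coordEquiv hx).apply_symm_apply] at this
    exact this.symm
  · intro h
    ext1 v
    rw [sigmaForm_eq_coordSigmaForm hK hx, h]
    rfl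

/-- The equation `sigmaForm K x = 0` is a closed condition. -/
theorem isClosed_setOf_sigmaForm_eq_zero (hK : IsSmooth K) :
    IsClosed {x | sigmaForm K x = 0} := by
  rw [isClosed_iff_frequently]
  intro p hp
  change sigmaForm K p = 0
  rw [sigmaForm_eq_zero_iff hK (mem_chart_source _ p)]
  by_contra hne
  have hsource := (chartAt (EuclideanSpace ℝ (Fin n)) p).open_source.mem_nhds
    (mem_chart_source _ p)
  refine hp ?_
  filter_upwards [hsource, (continuousAt_coordSigmaForm hK p).eventually_ne hne] with x hx hx0 h
  exact hx0 ((sigmaForm_eq_zero_iff hK hx).1 h)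

end Global

end HydroTensor

end

theorem theorem2 {n : ℕ} {M : Type*} [TopologicalSpace M]
    [ChartedSpace (EuclideanSpace ℝ (Fin n)) M] [IsManifold (𝓡 n) ∞ M]
    (K : HydroTensor.EndField n M) (hK : HydroTensor.IsSmooth K)
    (hreg : HydroTensor.IsGLRegular K) :
    (∀ p : M, HydroTensor.IsAlgebraicallyGeneric K p →
      (HydroTensor.IsWeaklyNonlinearAt K p ↔ HydroTensor.sigmaForm K p = 0)) ∧
    ((∀ p : M, HydroTensor.IsAlgebraicallyGeneric K p → HydroTensor.IsWeaklyNonlinearAt K p) ↔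
      ∀ p : M, HydroTensor.sigmaForm K p = 0) := by
  have hiff := fun p (hp : HydroTensor.IsAlgebraicallyGeneric K p) ↦
    HydroTensor.isWeaklyNonlinearAt_iff hK hreg hp
  refine ⟨hiff, fun h p ↦ ?_, fun h p hp ↦ (hiff p hp).2 (h p)⟩
  exact closure_minimal (fun x hx ↦ (hiff x hx).1 (h x hx))
    (HydroTensor.isClosed_setOf_sigmaForm_eq_zero hK)
    (HydroTensor.dense_isAlgebraicallyGeneric hK hreg p)
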